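/- For $n\ge 1$ let $S_n$ be the set of permutations of $\{1,\dots,n\}$, and let $\bigcup_{n\ge 1}S_n$ be ordered by consecutive pattern containment: $\sigma\le\tau$ if $\tau$ has a block of $|\sigma|$ adjacent entries in the same relative order as the entries of $\sigma$, where $|\sigma|$ is the length of $\sigma$. The order complex of an interval $[\sigma,\tau]$ of this poset is the simplicial complex whose faces are the chains of the open interval $(\sigma,\tau)=\{\pi:\sigma<\pi<\tau\}$ (including the empty chain, a face of dimension $-1$). A pure $d$-dimensional simplicial complex is shellable if its facets can be listed as $F_1,\dots,F_s$, each once, so that $\left(\bigcup_{j<k}F_j\right)\cap F_k$ is pure and $(d-1)$-dimensional for all $k=2,\dots,s$ (a facet being identified with the complex of all its subsets). The interval $[\sigma,\tau]$ is called shellable if its order complex is pure and shellable; if $\sigma\not\le\tau$, the order complex consists of the empty face only and $[\sigma,\tau]$ counts as shellable. Let $\sigma$ be a fixed permutation of positive length, and for $n\ge 1$ let $\tau$ be chosen uniformly at random from $S_n$. Then $$\lim_{n\to\infty}\mathbb{P}\big([\sigma,\tau]\text{ is shellable}\big)=0 .$$ -/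

import Mathlib

/-- A permutation of positive length: `⟨n, π⟩` with `π` a permutation of the `n`-element chain
`Fin n = {0, …, n - 1}` (positions and values are shifted down by one against `{1, …, n}`).
The one-line notation is `π 0, π 1, …, π (n - 1)`. -/
structure ConsPerm where
  len : ℕ+
  perm : Equiv.Perm (Fin len)

namespace ConsPerm

/-- `σ` occurs in `τ` at the adjacent positions `i, i + 1, …, i + |σ| - 1`: the entries of `τ` at
these positions are in the same relative order as the entries of `σ`. -/
def OccursAt (σ τ : ConsPerm) (i : ℕ) : Prop :=
  ∃ h : i + (σ.len : ℕ) ≤ τ.len, ∀ a b : Fin σ.len,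
    σ.perm a < σ.perm b ↔
      τ.perm ⟨i + a, by omega⟩ < τ.perm ⟨i + b, by omega⟩

theorem eq_of_occursAt {σ τ : ConsPerm} {i : ℕ} (h : OccursAt σ τ i)
    (hl : (τ.len : ℕ) ≤ σ.len) : σ = τ := by
  obtain ⟨n, p⟩ := σ
  obtain ⟨m, q⟩ := τ
  obtain ⟨h1, h2⟩ := h
  simp only at h1 h2 hl
  obtain rfl : n = m := PNat.coe_injective (by omega)
  obtain rfl : i = 0 := by omega
  simp only [zero_add, Fin.eta] at h2
  have hm : StrictMono (fun x => q (p.symm x)) := by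
    intro x y hxy
    have := (h2 (p.symm x) (p.symm y)).1 (by simpa using hxy)
    simpa using this
  have hm' : StrictMono (fun x => p (q.symm x)) := by
    intro x y hxy
    have := (h2 (q.symm x) (q.symm y)).2 (by simpa using hxy)
    simpa using this
  congr 1
  refine Equiv.ext fun a => ?_
  have e1 := hm.id_le (p a)
  have e2 := hm'.id_le (q a)
  simp only [id, Equiv.symm_apply_apply] at e1 e2
  exact le_antisymm e1 e2

/-- The consecutive pattern poset: `σ ≤ τ` if `σ` occurs in `τ` as a consecutive pattern. -/
instance : PartialOrder ConsPerm where
  le σ τ := ∃ i, OccursAt σ τ i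
  le_refl σ := ⟨0, by simp, fun a b => by simp⟩
  le_trans := by
    rintro ρ σ τ ⟨i, hi, h⟩ ⟨j, hj, h'⟩
    refine ⟨j + i, by omega, fun a b => ?_⟩
    rw [h a b, h' ⟨i + a, by omega⟩ ⟨i + b, by omega⟩]
    simp only [add_assoc]
  le_antisymm := by
    rintro σ τ ⟨i, h⟩ ⟨j, h', -⟩
    exact eq_of_occursAt h (by omega)

end ConsPerm

section Shellability

/-! An abstract simplicial complex is a downward closed family of finite sets, its faces. The empty
set counts as a face (of dimension `-1`), as is usual for shellings. -/

variable {V : Type*}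

/-- The facets of a simplicial complex: its inclusion-maximal faces. -/
def IsFacet (Δ : LowerSet (Finset V)) (F : Finset V) : Prop :=
  Maximal (fun G => G ∈ Δ) F

/-- `Δ` is pure and `d`-dimensional: it has a facet, and all its facets have dimension `d`, that is,
`d + 1` elements. -/
def IsPureOfDim (Δ : LowerSet (Finset V)) (d : ℤ) : Prop :=
  (∃ F, IsFacet Δ F) ∧ ∀ F, IsFacet Δ F → (F.card : ℤ) = d + 1

/-- `F 0, …, F (s - 1)` is a shelling of the pure `d`-dimensional complex `Δ`: it lists all facets
of `Δ`, each once, and for every `k` but the first, the intersection of `F k` with the union of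
the `F j`, `j < k`, is pure and `(d - 1)`-dimensional. Here a facet `F` stands for the complex
`LowerSet.Iic F` of all its subsets. -/
def IsShelling (Δ : LowerSet (Finset V)) (d : ℤ) {s : ℕ} (F : Fin s → Finset V) : Prop :=
  Function.Injective F ∧ Set.range F = {G | IsFacet Δ G} ∧
    ∀ k : Fin s, 0 < (k : ℕ) →
      IsPureOfDim ((⨆ j : Fin s, ⨆ _ : j < k, LowerSet.Iic (F j)) ⊓ LowerSet.Iic (F k)) (d - 1)

/-- A pure simplicial complex with finitely many facets is shellable if it has a shelling. -/
def IsShellable (Δ : LowerSet (Finset V)) : Prop :=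
  ∃ d : ℤ, IsPureOfDim Δ d ∧ ∃ (s : ℕ) (F : Fin s → Finset V), IsShelling Δ d F

/-- The order complex of the interval `[a, b]` of a poset: its faces are the finite chains of the
open interval `(a, b)`. -/
def orderComplex {P : Type*} [PartialOrder P] (a b : P) : LowerSet (Finset P) where
  carrier := {C | (C : Set P) ⊆ Set.Ioo a b ∧ IsChain (· ≤ ·) (C : Set P)}
  lower' := fun _ _ hDC hC =>
    ⟨(Finset.coe_subset.2 hDC).trans hC.1, hC.2.mono (Finset.coe_subset.2 hDC)⟩

/-- The interval `[a, b]` is shellable if its order complex is. (If `a ≤ b` fails, the open interval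
has no elements, the order complex consists of the empty face only, and it is shellable.) -/
def IntervalShellable {P : Type*} [PartialOrder P] (a b : P) : Prop :=
  IsShellable (orderComplex a b)

end Shellability

/-! ### Disconnected subintervals obstruct shellings -/

section Shellability

variable {P : Type*} [PartialOrder P]

/-! A shelling cannot pass between the parts of a disconnected open interval `(r, w)` without
isolated elements: each facet through `r` and `w` meets only one part, and a codimension-one face of
it through `r` and `w` still meets that part (`not_intervalShellable_of_separated`). Such an
interval is `(ρ, ω)` with `σ < ρ`, the first entry of `ρ` above its last, and `ω = ρ ⊕ ρ`: an
occurrence of `ρ` straddling both copies would start low and end high, so `ρ` occurs only as prefix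
and suffix. Thus `[σ, τ]` is not shellable once `ω < τ`. A random `τ` has about `n / |ω|` disjoint
blocks of length `|ω|`, each showing `ω` independently with probability `1 / |ω|!`, so it avoids `ω`
with probability tending to `0`. -/

theorem exists_isFacet_of_finite {V : Type*} {Δ : LowerSet (Finset V)}
    (h : {F : Finset V | F ∈ Δ}.Finite) {E : Finset V} (hE : E ∈ Δ) :
    ∃ F, IsFacet Δ F ∧ E ⊆ F := by
  obtain ⟨F, hEF, hF⟩ := h.exists_le_maximal (a := E) hE
  exact ⟨F, hF, hEF⟩

theorem finite_orderComplex {s t : P} (h : (Set.Ioo s t).Finite) :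
    {F : Finset P | F ∈ orderComplex s t}.Finite := by
  refine Set.Finite.subset (s := {F : Finset P | F ⊆ h.toFinset}) ?_ ?_
  · exact (Finset.finite_toSet h.toFinset.powerset).subset fun F hF => by simpa using hF
  · intro F hF x hx
    simpa using hF.1 hx

/-- A maximal chain through `r` and `w` has at least two elements strictly between `r` and `w`,
provided that every element of `(r, w)` is comparable to another one. -/
theorem exists_mem_Ioo_of_isFacet {s r w t : P} (hsr : s < r) (hwt : w < t)
    (hne : (Set.Ioo r w).Nonempty)
    (hc : ∀ x ∈ Set.Ioo r w, ∃ y ∈ Set.Ioo r w, x < y ∨ y < x)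
    {F G : Finset P} (hF : IsFacet (orderComplex s t) F) (hr : r ∈ F) (hw : w ∈ F)
    (hGF : G ⊆ F) (hG : F.card = G.card + 1) : ∃ x ∈ G, x ∈ Set.Ioo r w := by
  classical
  by_contra! hcon
  have h1 : (F \ G).card = 1 := by
    rw [Finset.card_sdiff_of_subset hGF]; omega
  obtain ⟨z, hz⟩ := Finset.card_eq_one.1 h1
  have key : ∀ x ∈ F, x ∈ Set.Ioo r w → x = z := fun x hx hx' => by
    have : x ∈ F \ G := Finset.mem_sdiff.2 ⟨hx, fun h => hcon x h hx'⟩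
    simpa [hz] using this
  -- At most `z` lies in `F` between `r` and `w`, so a `y ≠ z` there, comparable to `z` if need be,
  -- would enlarge `F`.
  obtain ⟨y, hy, hyz, hcmp⟩ :
      ∃ y ∈ Set.Ioo r w, y ≠ z ∧ (z ∈ Set.Ioo r w → y ≤ z ∨ z ≤ y) := by
    by_cases hzI : z ∈ Set.Ioo r w
    · obtain ⟨y, hy, h | h⟩ := hc z hzI
      · exact ⟨y, hy, h.ne', fun _ => Or.inr h.le⟩
      · exact ⟨y, hy, h.ne, fun _ => Or.inl h.le⟩
    · obtain ⟨y, hy⟩ := hne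
      exact ⟨y, hy, fun h => hzI (h ▸ hy), fun h => absurd h hzI⟩
  have hchain : IsChain (· ≤ ·) (F : Set P) := hF.prop.2
  have hins : insert y F ∈ orderComplex s t := by
    refine ⟨?_, ?_⟩
    · rw [Finset.coe_insert]
      exact Set.insert_subset ⟨hsr.trans hy.1, hy.2.trans hwt⟩ hF.prop.1
    · rw [Finset.coe_insert]
      refine hchain.insert fun b hb _ => ?_
      rcases hchain.total hr hb with hrb | hbr
      · rcases hchain.total hb hw with hbw | hwb
        · by_cases hbI : b ∈ Set.Ioo r w
          · obtain rfl := key b hb hbI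
            exact hcmp hbI
          · rcases hrb.eq_or_lt with rfl | hrb
            · exact Or.inr hy.1.le
            · rcases hbw.eq_or_lt with rfl | hbw
              · exact Or.inl hy.2.le
              · exact absurd ⟨hrb, hbw⟩ hbI
        · exact Or.inl (hy.2.le.trans hwb)
      · exact Or.inr (hbr.trans hy.1.le)
  have hyF : y ∈ F := hF.le_of_ge hins (Finset.subset_insert y F) (Finset.mem_insert_self y F)
  exact hyz (key y hyF hy)

/-- An interval is not shellable if it has a subinterval of rank at least three whose open interval
is disconnected. The two parts of `(r, w)` are given by a predicate `A`. -/
theorem not_intervalShellable_of_separated {s r w t : P} (A : P → Prop)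
    (hsr : s < r) (hrw : r < w) (hwt : w < t) (hfin : (Set.Ioo s t).Finite)
    (hA : ∀ x ∈ Set.Ioo r w, ∀ y ∈ Set.Ioo r w, x ≤ y → (A x ↔ A y))
    (ha : ∃ x ∈ Set.Ioo r w, A x) (hb : ∃ x ∈ Set.Ioo r w, ¬ A x)
    (hc : ∀ x ∈ Set.Ioo r w, ∃ y ∈ Set.Ioo r w, x < y ∨ y < x) :
    ¬ IntervalShellable s t := by
  classical
  rintro ⟨d, ⟨-, hd⟩, n, F, -, hrange, hsh⟩
  have hF : ∀ i, IsFacet (orderComplex s t) (F i) := fun i => by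
    have : F i ∈ Set.range F := ⟨i, rfl⟩
    rwa [hrange] at this
  have hcolor : ∀ i, ∀ x ∈ F i, ∀ y ∈ F i, x ∈ Set.Ioo r w → y ∈ Set.Ioo r w → (A x ↔ A y) := by
    intro i x hx y hy hxI hyI
    rcases (hF i).prop.2.total hx hy with h | h
    · exact hA x hxI y hyI h
    · exact (hA y hyI x hxI h).symm
  have hexists : ∀ x ∈ Set.Ioo r w, ∃ i, r ∈ F i ∧ w ∈ F i ∧ x ∈ F i := by
    intro x hx
    have hface : ({r, x, w} : Finset P) ∈ orderComplex s t := by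
      refine ⟨?_, ?_⟩
      · intro y hy
        simp only [Finset.coe_insert, Finset.coe_singleton, Set.mem_insert_iff,
          Set.mem_singleton_iff] at hy
        rcases hy with rfl | rfl | rfl
        · exact ⟨hsr, hrw.trans hwt⟩
        · exact ⟨hsr.trans hx.1, hx.2.trans hwt⟩
        · exact ⟨hsr.trans hrw, hwt⟩
      · intro y hy z hz _
        simp only [Finset.coe_insert, Finset.coe_singleton, Set.mem_insert_iff,
          Set.mem_singleton_iff] at hy hz
        have h1 := hx.1.le
        have h2 := hx.2.le
        have h3 := hrw.le
        rcases hy with rfl | rfl | rfl <;> rcases hz with rfl | rfl | rfl <;> simp [*]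
    obtain ⟨E, hE, hsub⟩ := exists_isFacet_of_finite (finite_orderComplex hfin) hface
    have : E ∈ Set.range F := by rw [hrange]; exact hE
    obtain ⟨i, rfl⟩ := this
    exact ⟨i, hsub (by simp), hsub (by simp), hsub (by simp)⟩
  -- Strong induction on the later facet `F k`.
  have hmain : ∀ k j : Fin n, j < k → r ∈ F j → w ∈ F j → r ∈ F k → w ∈ F k →
      ∀ x ∈ F j, ∀ y ∈ F k, x ∈ Set.Ioo r w → y ∈ Set.Ioo r w → (A x ↔ A y) := by
    intro k
    induction k using WellFoundedLT.induction with
    | ind k ih =>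
    intro j hjk hrj hwj hrk hwk x hx y hy hxI hyI
    obtain ⟨-, hpure⟩ := hsh k (by have : (j : ℕ) < k := hjk; omega)
    set Δ := (⨆ j : Fin n, ⨆ _ : j < k, LowerSet.Iic (F j)) ⊓ LowerSet.Iic (F k) with hΔ
    have hmem : ∀ E, E ∈ Δ ↔ (∃ l, l < k ∧ E ⊆ F l) ∧ E ⊆ F k := by
      intro E
      simp [hΔ]
    have hΔfin : {E : Finset P | E ∈ Δ}.Finite :=
      (Finset.finite_toSet (F k).powerset).subset fun E hE => by
        simpa using ((hmem E).1 hE).2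
    -- The face `{r, w}` extends to a codimension-one face `G` of `F k` lying in an earlier `F l`;
    -- `G` keeps an element of `(r, w)`, so `F k` and `F l` meet the same part.
    have hrwΔ : ({r, w} : Finset P) ∈ Δ := by
      rw [hmem]
      exact ⟨⟨j, hjk, by simp [Finset.insert_subset_iff, *]⟩,
        by simp [Finset.insert_subset_iff, *]⟩
    obtain ⟨G, hG, hsub⟩ := exists_isFacet_of_finite hΔfin hrwΔ
    obtain ⟨⟨l, hlk, hGl⟩, hGk⟩ := (hmem G).1 hG.prop
    have hcard : (F k).card = G.card + 1 := by
      have h1 := hd _ (hF k)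
      have h2 := hpure _ hG
      omega
    obtain ⟨z, hzG, hzI⟩ := exists_mem_Ioo_of_isFacet hsr hwt ⟨x, hxI⟩ hc (hF k) hrk hwk hGk hcard
    have hrl : r ∈ F l := hGl (hsub (by simp))
    have hwl : w ∈ F l := hGl (hsub (by simp))
    refine Iff.trans ?_ (hcolor k z (hGk hzG) y hy hzI hyI)
    rcases lt_trichotomy j l with h | rfl | h
    · exact ih l hlk j h hrj hwj hrl hwl x hx z (hGl hzG) hxI hzI
    · exact hcolor j x hx z (hGl hzG) hxI hzI
    · exact (ih j hjk l h hrl hwl hrj hwj z (hGl hzG) x hx hzI hxI).symm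
  obtain ⟨a, haI, haA⟩ := ha
  obtain ⟨b, hbI, hbA⟩ := hb
  obtain ⟨i, hri, hwi, hai⟩ := hexists a haI
  obtain ⟨j, hrj, hwj, hbj⟩ := hexists b hbI
  rcases lt_trichotomy i j with h | rfl | h
  · exact hbA ((hmain j i h hri hwi hrj hwj a hai b hbj haI hbI).1 haA)
  · exact hbA ((hcolor i a hai b hbj haI hbI).1 haA)
  · exact hbA ((hmain i j h hrj hwj hri hwi b hbj a hai hbI haI).2 haA)

end Shellability

/-! ### Windows in the consecutive pattern poset -/

namespace ConsPerm

/-- The standardization of an injective finite sequence. -/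
theorem exists_perm_lt_iff {α : Type*} [LinearOrder α] {n : ℕ} (f : Fin n → α)
    (hf : Function.Injective f) :
    ∃ π : Equiv.Perm (Fin n), ∀ a b, π a < π b ↔ f a < f b := by
  have hm : StrictMono (f ∘ Tuple.sort f) :=
    (Tuple.monotone_sort f).strictMono_of_injective (hf.comp (Tuple.sort f).injective)
  refine ⟨(Tuple.sort f).symm, fun a b => ?_⟩
  rw [← hm.lt_iff_lt]
  simp

theorem OccursAt.trans {ρ σ τ : ConsPerm} {i j : ℕ} (h : OccursAt ρ σ i) (h' : OccursAt σ τ j) :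
    OccursAt ρ τ (j + i) := by
  obtain ⟨hi, h⟩ := h
  obtain ⟨hj, h'⟩ := h'
  refine ⟨by omega, fun a b => ?_⟩
  rw [h a b, h' ⟨i + a, by omega⟩ ⟨i + b, by omega⟩]
  simp only [add_assoc]

theorem OccursAt.le {σ τ : ConsPerm} {i : ℕ} (h : OccursAt σ τ i) : σ ≤ τ := ⟨i, h⟩

theorem len_le_of_le {σ τ : ConsPerm} (h : σ ≤ τ) : (σ.len : ℕ) ≤ τ.len := by
  obtain ⟨i, h, -⟩ := h
  omega

theorem len_lt_of_lt {σ τ : ConsPerm} (h : σ < τ) : (σ.len : ℕ) < τ.len := by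
  by_contra! hl
  obtain ⟨i, hi⟩ := h.le
  exact h.ne (eq_of_occursAt hi hl)

theorem lt_of_le_of_len_lt {σ τ : ConsPerm} (h : σ ≤ τ) (hl : (σ.len : ℕ) < τ.len) : σ < τ :=
  lt_of_le_of_ne h (by rintro rfl; omega)

theorem finite_Iic (τ : ConsPerm) : (Set.Iic τ).Finite := by
  have : (Set.range fun p : (n : Fin (τ.len + 1)) × Equiv.Perm (Fin (n + 1)) =>
      (⟨⟨p.1 + 1, Nat.succ_pos _⟩, p.2⟩ : ConsPerm)).Finite := Set.finite_range _
  refine this.subset ?_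
  rintro ⟨⟨n, hn⟩, π⟩ h
  have hl : n ≤ τ.len := len_le_of_le h
  obtain ⟨m, rfl⟩ : ∃ m, n = m + 1 := ⟨n - 1, by omega⟩
  exact ⟨⟨⟨m, by omega⟩, π⟩, rfl⟩

/-- The pattern of `τ` at the `l` adjacent positions that start at `i`; any `ρ` that occurs at
positions within this window occurs in this pattern. -/
theorem exists_window (τ : ConsPerm) {i l : ℕ} (hl : 0 < l) (h : i + l ≤ τ.len) :
    ∃ π : ConsPerm, (π.len : ℕ) = l ∧ OccursAt π τ i ∧
      ∀ (ρ : ConsPerm) (j : ℕ), j + ρ.len ≤ l → OccursAt ρ τ (i + j) → OccursAt ρ π j := by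
  obtain ⟨π, hπ⟩ := exists_perm_lt_iff (fun a : Fin l => τ.perm ⟨i + a, by omega⟩) (by
    intro a b hab
    have := τ.perm.injective hab
    simp only [Fin.mk.injEq] at this
    exact Fin.ext (by omega))
  refine ⟨⟨⟨l, hl⟩, π⟩, rfl, ⟨h, hπ⟩, fun ρ j hj hρ => ⟨hj, fun a b => ?_⟩⟩
  obtain ⟨_, hρ⟩ := hρ
  rw [hρ a b]
  refine Iff.trans ?_ (hπ ⟨j + a, by omega⟩ ⟨j + b, by omega⟩).symm
  simp only [add_assoc]

theorem exists_between {ρ τ : ConsPerm} (h : ρ ≤ τ) (hl : (ρ.len : ℕ) + 1 < τ.len) :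
    ∃ x, ρ < x ∧ x < τ := by
  obtain ⟨q, hq⟩ := h
  have hq1 := hq.1
  by_cases hlt : q + ρ.len < τ.len
  · obtain ⟨π, hπ, h1, h2⟩ := exists_window τ (i := q) (l := ρ.len + 1) (by omega) (by omega)
    exact ⟨π, lt_of_le_of_len_lt (h2 ρ 0 (by omega) hq).le (by omega),
      lt_of_le_of_len_lt h1.le (by omega)⟩
  -- `ρ` is a suffix here, so its window grows to the left.
  · obtain ⟨π, hπ, h1, h2⟩ := exists_window τ (i := q - 1) (l := ρ.len + 1) (by omega) (by omega)
    refine ⟨π, lt_of_le_of_len_lt (h2 ρ 1 (by omega) ?_).le (by omega),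
      lt_of_le_of_len_lt h1.le (by omega)⟩
    rwa [show q - 1 + 1 = q by omega]

/-- If `ρ` occurs in `ω` exactly twice, as a prefix and as a suffix, then `(ρ, ω)` is disconnected;
hence no interval that contains `[ρ, ω]` in its interior is shellable. -/
theorem not_intervalShellable_of_two_occurrences {σ ρ ω τ : ConsPerm} (hσρ : σ < ρ) (hωτ : ω < τ)
    (hl : (ρ.len : ℕ) + 3 ≤ ω.len) (hpre : OccursAt ρ ω 0)
    (hsuf : OccursAt ρ ω (ω.len - ρ.len))
    (honly : ∀ i, OccursAt ρ ω i → i = 0 ∨ i + ρ.len = ω.len) :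
    ¬ IntervalShellable σ τ := by
  have hρω : ρ < ω := lt_of_le_of_len_lt hpre.le (by omega)
  -- Each element of `(ρ, ω)` is a prefix or a suffix of `ω`, never both: otherwise `ρ` would occur
  -- at a third position.
  refine not_intervalShellable_of_separated (fun x => OccursAt x ω 0) hσρ hρω hωτ
    ((finite_Iic τ).subset fun x hx => hx.2.le) ?_ ?_ ?_ ?_
  · rintro x ⟨hρx, hxω⟩ y ⟨hρy, hyω⟩ ⟨r, hr⟩
    have hx1 := len_lt_of_lt hρx
    have hx2 := len_lt_of_lt hxω
    have hy2 := len_lt_of_lt hyω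
    obtain ⟨q, hq⟩ := hρx.le
    have hr1 := hr.1
    have hq1 := hq.1
    constructor
    · intro h
      obtain ⟨p, hp⟩ := hyω.le
      have hp1 := hp.1
      have e1 := honly _ (hq.trans h)
      have e2 := honly _ (hq.trans (hr.trans hp))
      obtain rfl : p = 0 := by omega
      exact hp
    · intro h
      have e1 := honly _ (hq.trans (hr.trans h))
      have := hr.trans h
      obtain rfl : r = 0 := by omega
      exact this
  · obtain ⟨π, hπ, h1, h2⟩ := exists_window ω (i := 0) (l := ρ.len + 1) (by omega) (by omega)
    exact ⟨π, ⟨lt_of_le_of_len_lt (h2 ρ 0 (by omega) hpre).le (by omega),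
      lt_of_le_of_len_lt h1.le (by omega)⟩, h1⟩
  · obtain ⟨π, hπ, h1, h2⟩ := exists_window ω (i := ω.len - ρ.len - 1) (l := ρ.len + 1)
      (by omega) (by omega)
    have h3 : OccursAt ρ π 1 := h2 ρ 1 (by omega) (by
      rwa [show (ω.len - ρ.len - 1 + 1 : ℕ) = ω.len - ρ.len by omega])
    refine ⟨π, ⟨lt_of_le_of_len_lt h3.le (by omega), lt_of_le_of_len_lt h1.le (by omega)⟩,
      fun h => ?_⟩
    have := honly _ (h3.trans h)
    omega
  · rintro x ⟨hρx, hxω⟩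
    -- Go down from `x` if there is room; otherwise `|x| = |ρ| + 1` and `|ω| ≥ |ρ| + 3` leaves room
    -- above.
    by_cases hx : (ρ.len : ℕ) + 1 < x.len
    · obtain ⟨y, h1, h2⟩ := exists_between hρx.le hx
      exact ⟨y, ⟨h1, h2.trans hxω⟩, Or.inr h2⟩
    · obtain ⟨y, h1, h2⟩ := exists_between hxω.le (by omega)
      exact ⟨y, ⟨hρx.trans h1, h2⟩, Or.inl h1⟩

/-! ### The patterns `ρ` and `ω = ρ ⊕ ρ` -/

/-- Two smaller entries can be appended to `σ`. -/
theorem exists_append_descents (σ : ConsPerm) :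
    ∃ ρ : ConsPerm, σ < ρ ∧ 3 ≤ (ρ.len : ℕ) ∧
      ρ.perm ⟨ρ.len - 1, Nat.sub_lt ρ.len.pos one_pos⟩ < ρ.perm ⟨0, ρ.len.pos⟩ := by
  have hpos := σ.len.pos
  -- Appended values are negative, hence below all of `σ`. Two of them give `|ρ| ≥ 3` even if `|σ| =
  -- 1`, so that `2|ρ| ≥ |ρ| + 3`.
  obtain ⟨π, hπ⟩ := exists_perm_lt_iff (n := σ.len + 2)
    (fun a => if h : (a : ℕ) < σ.len then ((σ.perm ⟨a, h⟩ : ℕ) : ℤ) else -(a : ℤ)) (by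
    intro a b hab
    dsimp only at hab
    split_ifs at hab with h1 h2 h2
    · have := σ.perm.injective (Fin.ext (by exact_mod_cast hab))
      simp only [Fin.mk.injEq] at this
      exact Fin.ext this
    · omega
    · omega
    · exact Fin.ext (by omega))
  refine ⟨⟨⟨σ.len + 2, by omega⟩, π⟩, lt_of_le_of_len_lt ⟨0, ?_, fun a b => ?_⟩ ?_, ?_, ?_⟩
  · simp
  · refine Iff.trans ?_ (hπ _ _).symm
    simp
  · simp
  · simp only [PNat.mk_coe]; omega
  · refine (hπ _ _).2 ?_
    simp
    omega

/-- The direct sum of `ρ` with itself contains `ρ` just twice if the first entry of `ρ` is larger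
than its last one. -/
theorem exists_two_occurrences (ρ : ConsPerm)
    (h : ρ.perm ⟨ρ.len - 1, Nat.sub_lt ρ.len.pos one_pos⟩ < ρ.perm ⟨0, ρ.len.pos⟩) :
    ∃ ω : ConsPerm, (ω.len : ℕ) = ρ.len + ρ.len ∧ OccursAt ρ ω 0 ∧ OccursAt ρ ω ρ.len ∧
      ∀ i, OccursAt ρ ω i → i = 0 ∨ i + ρ.len = ω.len := by
  have hpos := ρ.len.pos
  obtain ⟨π, hπ⟩ := exists_perm_lt_iff (n := ρ.len + ρ.len)
    (fun a => if h : (a : ℕ) < ρ.len then (ρ.perm ⟨a, h⟩ : ℕ)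
      else ρ.len + ρ.perm ⟨a - ρ.len, by omega⟩) (by
    intro a b hab
    dsimp only at hab
    split_ifs at hab with h1 h2 h2
    · have := ρ.perm.injective (Fin.ext hab)
      simp only [Fin.mk.injEq] at this
      exact Fin.ext this
    · omega
    · omega
    · have := ρ.perm.injective (Fin.ext (Nat.add_left_cancel hab))
      simp only [Fin.mk.injEq] at this
      exact Fin.ext (by omega))
  refine ⟨⟨⟨ρ.len + ρ.len, by omega⟩, π⟩, rfl, ⟨?_, fun a b => ?_⟩, ⟨?_, fun a b => ?_⟩, ?_⟩
  · simp
  · refine Iff.trans ?_ (hπ _ _).symm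
    simp
  · simp
  · refine Iff.trans ?_ (hπ _ _).symm
    simp
  · rintro i ⟨hi, hocc⟩
    by_contra! hcon
    simp only [PNat.mk_coe] at hi hcon
    -- For `0 < i < |ρ|` the occurrence begins in the lower copy and ends in the upper one, contrary
    -- to `h`.
    have h1 := (hocc _ _).1 h
    have h2 := (hπ _ _).1 h1
    simp only at h2
    rw [dif_neg (by omega), dif_pos (by omega)] at h2
    omega

/-! ### Counting permutations that avoid `ω` in disjoint blocks -/

/-- If a set of permutations is closed under rearrangements of the entries at the positions
`f 0, f 1, …`, then at least one in `L!` of its elements has the pattern `ω` there. -/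
theorem card_le_factorial_mul_card {n L : ℕ} (f : Fin L ↪ Fin n) (ω : Equiv.Perm (Fin L))
    (A : Finset (Equiv.Perm (Fin n)))
    (hA : ∀ τ ∈ A, ∀ s : Equiv.Perm (Fin L), τ * s.viaFintypeEmbedding f ∈ A) :
    A.card ≤ L.factorial *
      (A.filter fun τ => ∀ a b, ω a < ω b ↔ τ (f a) < τ (f b)).card := by
  classical
  have hs : ∀ τ : Equiv.Perm (Fin n), ∃ s : Equiv.Perm (Fin L),
      ∀ a b, ω a < ω b ↔ τ (f (s a)) < τ (f (s b)) := by
    intro τ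
    obtain ⟨π, hπ⟩ := exists_perm_lt_iff (fun a => τ (f a)) (τ.injective.comp f.injective)
    exact ⟨ω.trans π.symm, fun a b => by rw [← hπ]; simp⟩
  choose s hs using hs
  have : L.factorial = (Finset.univ : Finset (Equiv.Perm (Fin L))).card := by
    rw [Finset.card_univ, Fintype.card_perm, Fintype.card_fin]
  rw [this, ← Finset.card_product]
  -- Sort the chosen entries of `τ` into the pattern `ω` and record the rearrangement, which can be
  -- undone.
  refine Finset.card_le_card_of_injOn (fun τ => (s τ, τ * (s τ).viaFintypeEmbedding f)) ?_ ?_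
  · intro τ hτ
    simp only [Finset.coe_product, Set.mem_prod, Finset.mem_coe, Finset.mem_univ, true_and,
      Finset.mem_filter]
    refine ⟨hA τ hτ _, fun a b => ?_⟩
    simpa [Equiv.Perm.viaFintypeEmbedding_apply_image] using hs τ a b
  · intro τ _ τ' _ h
    simp only [Prod.mk.injEq] at h
    obtain ⟨h1, h2⟩ := h
    rw [h1] at h2
    exact mul_right_cancel h2

/-- Rearranging entries within block `q` leaves the earlier blocks untouched, so among the
permutations avoiding `ω` there, at least a fraction `1 / |ω|!` have it in block `q`. -/
theorem card_avoiding_blocks_le (ω : ConsPerm) (n : ℕ+) (q : ℕ) (hq : q * ω.len ≤ n) :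
    (Nat.card {τ : Equiv.Perm (Fin n) // ∀ j < q, ¬ OccursAt ω ⟨n, τ⟩ (j * ω.len)} : ℝ) ≤
      (1 - 1 / ((ω.len : ℕ).factorial : ℝ)) ^ q * (n : ℕ).factorial := by
  classical
  induction q with
  | zero => simp [Fintype.card_perm]
  | succ q ih =>
    rw [Nat.succ_mul] at hq
    specialize ih (by omega)
    set A : Finset (Equiv.Perm (Fin n)) :=
      Finset.univ.filter fun τ => ∀ j < q, ¬ OccursAt ω ⟨n, τ⟩ (j * ω.len) with hAdef
    let f : Fin ω.len ↪ Fin n := ⟨fun a => ⟨q * ω.len + a, by omega⟩, fun a b h => by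
      simp only [Fin.mk.injEq] at h
      exact Fin.ext (by omega)⟩
    have hA : ∀ τ ∈ A, ∀ s : Equiv.Perm (Fin ω.len), τ * s.viaFintypeEmbedding f ∈ A := by
      intro τ hτ s
      simp only [hAdef, Finset.mem_filter, Finset.mem_univ, true_and] at hτ ⊢
      intro j hj hocc
      refine hτ j hj ?_
      obtain ⟨h1, h2⟩ := hocc
      refine ⟨h1, fun a b => ?_⟩
      have hfix : ∀ a : Fin ω.len, s.viaFintypeEmbedding f ⟨j * ω.len + a, by
          have := a.isLt; simp only at h1; omega⟩ = ⟨j * ω.len + a, by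
          have := a.isLt; simp only at h1; omega⟩ := by
        intro a
        refine Equiv.Perm.viaFintypeEmbedding_apply_notMem_range _ _ ?_
        rintro ⟨b, hb⟩
        have hb' : q * ω.len + (b : ℕ) = j * ω.len + a := congrArg Fin.val hb
        have : (j + 1) * (ω.len : ℕ) ≤ q * ω.len := Nat.mul_le_mul_right _ hj
        rw [Nat.succ_mul] at this
        omega
      rw [h2 a b]
      simp only [Equiv.Perm.mul_apply, hfix]
    have hcard := card_le_factorial_mul_card f ω.perm A hA
    have hsplit := Finset.card_filter_add_card_filter_not (s := A)
      (fun τ => ∀ a b, ω.perm a < ω.perm b ↔ τ (f a) < τ (f b))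
    have hnew : Nat.card {τ : Equiv.Perm (Fin n) //
        ∀ j < q + 1, ¬ OccursAt ω ⟨n, τ⟩ (j * ω.len)} =
        (A.filter fun τ => ¬ ∀ a b, ω.perm a < ω.perm b ↔ τ (f a) < τ (f b)).card := by
      rw [Nat.card_eq_fintype_card, Fintype.card_subtype, hAdef, Finset.filter_filter]
      congr 1
      refine Finset.filter_congr fun τ _ => ?_
      rw [Nat.forall_lt_succ_right]
      refine and_congr_right fun _ => not_congr ⟨fun h => h.2, fun h => ⟨hq, h⟩⟩
    have hold : Nat.card {τ : Equiv.Perm (Fin n) //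
        ∀ j < q, ¬ OccursAt ω ⟨n, τ⟩ (j * ω.len)} = A.card := by
      rw [Nat.card_eq_fintype_card, Fintype.card_subtype]
    rw [hold] at ih
    rw [hnew]
    have hL : (1 : ℝ) ≤ ((ω.len : ℕ).factorial : ℝ) := by
      exact_mod_cast Nat.factorial_pos _
    set L : ℝ := ((ω.len : ℕ).factorial : ℝ)
    set b := (A.filter fun τ => ∀ a b, ω.perm a < ω.perm b ↔ τ (f a) < τ (f b)).card
    set c := (A.filter fun τ => ¬ ∀ a b, ω.perm a < ω.perm b ↔ τ (f a) < τ (f b)).card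
    have h1 : (A.card : ℝ) ≤ L * b := by
      rw [← Nat.cast_mul]
      exact Nat.cast_le.2 hcard
    have h2 : (b : ℝ) + c = A.card := by exact_mod_cast hsplit
    have h3 : (A.card : ℝ) / L ≤ b := by
      rw [div_le_iff₀ (by linarith)]; linarith
    calc (c : ℝ) = A.card - b := by linarith
      _ ≤ A.card - A.card / L := by linarith
      _ = (1 - 1 / L) * A.card := by ring
      _ ≤ (1 - 1 / L) * ((1 - 1 / L) ^ q * (n : ℕ).factorial) := by
        refine mul_le_mul_of_nonneg_left ih ?_
        rw [sub_nonneg, div_le_one (by linarith)]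
        exact hL
      _ = _ := by ring

end ConsPerm

open ConsPerm in
theorem corollary4p1 (σ : ConsPerm) :
    Filter.Tendsto
      (fun n : ℕ+ =>
        (Nat.card {τ : Equiv.Perm (Fin n) // IntervalShellable σ (ConsPerm.mk n τ)} : ℝ) /
          (Nat.card (Equiv.Perm (Fin n)) : ℝ))
      Filter.atTop (nhds 0) := by
  obtain ⟨ρ, hσρ, hρ3, hρ⟩ := exists_append_descents σ
  obtain ⟨ω, hlen, hpre, hsuf, honly⟩ := exists_two_occurrences ρ hρ
  have hL : (1 : ℝ) ≤ ((ω.len : ℕ).factorial : ℝ) := by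
    exact_mod_cast Nat.factorial_pos _
  have hbase : 0 ≤ 1 - 1 / ((ω.len : ℕ).factorial : ℝ) := by
    rw [sub_nonneg, div_le_one (by linarith)]
    exact hL
  have hbase' : 1 - 1 / ((ω.len : ℕ).factorial : ℝ) < 1 := by
    have : 0 < 1 / ((ω.len : ℕ).factorial : ℝ) := by positivity
    linarith
  have hdiv : Filter.Tendsto (fun n : ℕ+ => (n : ℕ) / (ω.len : ℕ)) Filter.atTop Filter.atTop :=
    (Nat.tendsto_div_const_atTop ω.len.ne_zero).comp
      (Filter.tendsto_atTop_atTop.2 fun b => ⟨b.succPNat, fun n hn => by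
        have : b + 1 ≤ (n : ℕ) := hn
        omega⟩)
  refine squeeze_zero' (Filter.Eventually.of_forall fun n => by positivity) ?_
    ((tendsto_pow_atTop_nhds_zero_of_lt_one hbase hbase').comp hdiv)
  -- `n > |ω|` makes an occurrence of `ω` in `τ` strict, so `ω` lies inside the open interval.
  filter_upwards [Filter.eventually_gt_atTop ω.len] with n hn
  have hn' : (ω.len : ℕ) < n := hn
  rw [Nat.card_eq_fintype_card (α := Equiv.Perm (Fin n)), Fintype.card_perm, Fintype.card_fin,
    div_le_iff₀ (by exact_mod_cast Nat.factorial_pos _)]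
  refine le_trans ?_ (card_avoiding_blocks_le ω n _ (Nat.div_mul_le_self _ _))
  refine Nat.cast_le.2 (Nat.card_mono (Set.toFinite {τ : Equiv.Perm (Fin n) |
    ∀ j < (n : ℕ) / (ω.len : ℕ), ¬ OccursAt ω ⟨n, τ⟩ (j * ω.len)}) ?_)
  intro τ hτ j _ hocc
  refine not_intervalShellable_of_two_occurrences hσρ
    (lt_of_le_of_len_lt hocc.le hn') (by omega) hpre ?_ honly hτ
  rwa [hlen, Nat.add_sub_cancel]
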